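/- Let $\mathbb N=\{1,2,3,\dots\}$. For a property $P$ of positive integers, let $\mathrm{Prob}\{n\in\mathbb N:P(n)\}:=\lim_{N\to\infty}\frac1N\#\{k\le N:P(k)\}$, if this limit exists. Let $F_1=1$, $F_2=2$, $F_{n+2}=F_{n+1}+F_n$, let $\phi=\frac{1+\sqrt5}2$ and $\omega=\phi^{-1}$. **Leading blocks.** Let $\mathcal F$ be the set of nonempty finite tuples $\epsilon=(\epsilon(1),\dots,\epsilon(t))$ with $\epsilon(1)=1$, all $\epsilon(k)\in\{0,1\}$, and $\epsilon(k)\epsilon(k+1)=0$ for $1\le k<t$; let $\mathcal F_s$ be the set of its members of length $s$. Every positive integer $n$ is uniquely $n=\sum_{k=1}^t\epsilon(k)F_{t-k+1}$ with $\epsilon\in\mathcal F$ (the Zeckendorf expansion); put $\mathrm{LB}_s(n):=(\epsilon(1),\dots,\epsilon(s))$ if $t\ge s$, and leave it undefined otherwise. Order tuples of length $s$ by $\mathbf b<\mathbf c$ iff $\sum_{k=1}^s\mathbf b(k)\omega^{k-1}<\sum_{k=1}^s\mathbf c(k)\omega^{k-1}$. The statements $\mathrm{LB}_s(n)=\mathbf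 b$ and $\mathrm{LB}_s(n)\le\mathbf b$ are false when $\mathrm{LB}_s(n)$ is undefined. **Continuous leading block distribution.** Let $\mathcal F^*$ be the set of infinite $0$-$1$ sequences $\mu=(\mu(1),\mu(2),\dots)$ with $\mu(k)\mu(k+1)=0$ for all $k$ and with no tail equal to $(1,0,1,0,\dots)$, and put $\mu|s:=(\mu(1),\dots,\mu(s))$. A sequence $K=(K_n)_{n\ge1}$ of positive integers tending to $\infty$ has *continuous leading block distribution under $\mathcal F$-expansion* if 1. $\mathrm{Prob}\{n:\mathrm{LB}_s(K_n)=\mathbf b\}$ exists for every $s\ge2$ and $\mathbf b\in\mathcal F_s$; 2. $\lim_{s\to\infty}\mathrm{Prob}\{n:\mathrm{LB}_s(K_n)\le\mu|s\}$ exists for every $\mu\in\mathcal F^*$ with $\mu(1)=1$; and 3. the function $f_K^*$ on $[0,1]$ given by $f_K^*(0)=0$, $f_K^*(1)=1$ and $f_K^*\big(\phi\big(\sum_{k\ge1}\mu(k)\omega^{k-1}-1\big)\big)=\lim_{s\to\infty}\mathrm{Prob}\{n:\mathrm{LB}_s(K_n)\le\mu|s\}$ for every $\mu\in\mathcal F^*$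 with $\mu(1)=1$ is well defined, continuous and strictly increasing. **Uniform continuations.** A continuous function $f:[1,\infty)\to\mathbb R$ is a *uniform continuation of $F$* if $f(n)=F_n$ for all $n\in\mathbb N$ and the functions $f_n(p)=\frac{f(n+p)-f(n)}{f(n+1)-f(n)}$ map $[0,1]$ into $[0,1]$ and converge uniformly on $[0,1]$ to a continuous strictly increasing function as $n\to\infty$. **Theorem.** Let $K=(K_n)_{n\ge1}$ be a sequence of positive integers with $K_n\to\infty$. Then $K$ has continuous leading block distribution under $\mathcal F$-expansion if and only if there is an injective uniform continuation $f$ of $F$ such that the fractional parts $\{f^{-1}(K_n)\}$ are equidistributed, that is, $\mathrm{Prob}\{n\in\mathbb N:\{f^{-1}(K_n)\}\le\beta\}=\beta$ for all $\beta\in[0,1]$. -/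

import Mathlib

open Filter Topology Set

namespace ZeckBenford

/-- The shifted Fibonacci sequence `F₁ = 1`, `F₂ = 2`, `F_{n+2} = F_{n+1} + F_n`
(only the indices `n ≥ 1` are used). -/
def F (n : ℕ) : ℕ := Nat.fib (n + 1)

/-- `ω = φ⁻¹`, where `φ` is the golden ratio. -/
noncomputable def omega : ℝ := Real.goldenRatio⁻¹

/-- `Prob{n ∈ ℕ : P(n)}` exists and equals `p`: the natural density of `P` over the positive
integers is `p`. -/
def HasProb (P : ℕ → Prop) (p : ℝ) : Prop :=
  Tendsto (fun n : ℕ => (Set.ncard {k : ℕ | 1 ≤ k ∧ k ≤ n ∧ P k} : ℝ) / (n : ℝ)) atTop (𝓝 p)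

/-- Membership in the set `𝓕` of Zeckendorf coefficient functions: nonempty tuples with positive
first entry, all entries `≤ 1`, and no two consecutive nonzero entries. The entry `ε(k)` of a
tuple of length `t` is written `ε ⟨k - 1, _⟩`. -/
structure IsCoeff {t : ℕ} (ε : Fin t → ℕ) : Prop where
  pos : 0 < t
  head_pos : 0 < ε ⟨0, pos⟩
  le_one : ∀ i, ε i ≤ 1
  no_consecutive : ∀ (i : ℕ) (hi : i + 1 < t), ε ⟨i, by omega⟩ * ε ⟨i + 1, hi⟩ = 0

/-- The product `ε * Q = ∑_{k=1}^t ε(k) Q_{t-k+1}`. -/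
def conv {t : ℕ} (ε : Fin t → ℕ) (Q : ℕ → ℕ) : ℕ := ∑ i : Fin t, ε i * Q (t - i)

/-- `IsLeadingBlock s n b` means that `LB_s(n)` is defined and equal to `b`: the Zeckendorf
expansion `n = ε * F`, `ε ∈ 𝓕`, has length at least `s`, and `b = (ε(1), …, ε(s))`. -/
def IsLeadingBlock (s n : ℕ) (b : Fin s → ℕ) : Prop :=
  ∃ (t : ℕ) (hst : s ≤ t) (ε : Fin t → ℕ),
    IsCoeff ε ∧ n = conv ε F ∧ ∀ i : Fin s, b i = ε (Fin.castLE hst i)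

/-- The finite dot product `b · F̂ = ∑_{k=1}^s b(k) ω^{k-1}`. -/
noncomputable def dotHat {s : ℕ} (b : Fin s → ℕ) : ℝ := ∑ i : Fin s, (b i : ℝ) * omega ^ (i : ℕ)

/-- The order on tuples of length `s`: `b < c` means `b · F̂ < c · F̂`. -/
def BlockLE {s : ℕ} (b c : Fin s → ℕ) : Prop := b = c ∨ dotHat b < dotHat c

/-- `LB_s(n) ≤ c` (in particular `LB_s(n)` is defined). -/
def LBLE (s n : ℕ) (c : Fin s → ℕ) : Prop :=
  ∃ b : Fin s → ℕ, IsLeadingBlock s n b ∧ BlockLE b c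

/-- The set `𝓕*` of Zeckendorf expressions for the interval `(0,1)`: infinite tuples with entries
`≤ 1`, no two consecutive nonzero entries, and no tail equal to `(1,0,1,0,…)`. The entry `μ(k)` is
written `μ (k - 1)`. -/
structure IsInfExpr (μ : ℕ → ℕ) : Prop where
  le_one : ∀ k, μ k ≤ 1
  no_consecutive : ∀ k, μ k * μ (k + 1) = 0
  tail_ne : ∀ j, (fun n => μ (j + n)) ≠ fun n => if Even n then 1 else 0

/-- The truncation `μ|s = (μ(1), …, μ(s))`. -/
def trunc (μ : ℕ → ℕ) (s : ℕ) : Fin s → ℕ := fun i => μ i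

/-- The infinite dot product `μ · F̂ = ∑_{k ≥ 1} μ(k) ω^{k-1}` (convergent when `μ` is bounded). -/
noncomputable def infDotHat (μ : ℕ → ℕ) : ℝ := ∑' k : ℕ, (μ k : ℝ) * omega ^ k

/-- Strong leading block distribution: `Prob{n : LB_s(K_n) = b}` exists for all `s ≥ 2` and all
blocks `b` of length `s`. -/
def HasStrongLeadingBlockDistribution (K : ℕ → ℕ) : Prop :=
  ∀ s : ℕ, 2 ≤ s → ∀ b : Fin s → ℕ, IsCoeff b →
    ∃ p : ℝ, HasProb (fun n => IsLeadingBlock s (K n) b) p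

/-- Continuous leading block distribution: `K` has strong leading block distribution, the limits
`lim_{s→∞} Prob{n : LB_s(K_n) ≤ μ|s}` exist for all `μ ∈ 𝓕*` with `μ(1) = 1`, and the function
`g = f_K^*` on `[0,1]` with `g 0 = 0`, `g 1 = 1` and with value at `φ (μ · F̂ - 1)` equal to that
limit is continuous and (strictly) increasing. -/
def HasContinuousLeadingBlockDistribution (K : ℕ → ℕ) : Prop :=
  HasStrongLeadingBlockDistribution K ∧
  ∃ g : ℝ → ℝ, g 0 = 0 ∧ g 1 = 1 ∧
    (∀ μ : ℕ → ℕ, IsInfExpr μ → μ 0 = 1 →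
      ∃ q : ℕ → ℝ, (∀ s : ℕ, 2 ≤ s → HasProb (fun n => LBLE s (K n) (trunc μ s)) (q s)) ∧
        Tendsto q atTop (𝓝 (g (Real.goldenRatio * (infDotHat μ - 1))))) ∧
    ContinuousOn g (Icc 0 1) ∧ StrictMonoOn g (Icc 0 1)

/-- The normalized piece `h_n(p) = (h(n+p) - h(n)) / (h(n+1) - h(n))`. -/
noncomputable def piece (h : ℝ → ℝ) (n : ℕ) (p : ℝ) : ℝ :=
  (h (n + p) - h n) / (h (n + 1) - h n)

/-- `h`, regarded as a function on `[1,∞)`, is a uniform continuation of the increasing sequence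
`H₁ < H₂ < ⋯` of positive integers. -/
structure IsUniformContinuation (H : ℕ → ℕ) (h : ℝ → ℝ) : Prop where
  continuousOn : ContinuousOn h (Ici 1)
  interpolates : ∀ n : ℕ, 1 ≤ n → h n = H n
  piece_mapsTo : ∀ n : ℕ, 1 ≤ n → MapsTo (piece h n) (Icc 0 1) (Icc 0 1)
  exists_limit : ∃ hInf : ℝ → ℝ,
    ContinuousOn hInf (Icc 0 1) ∧ StrictMonoOn hInf (Icc 0 1) ∧
    TendstoUniformlyOn (piece h) hInf atTop (Icc 0 1)

/-- The fractional parts `{x_n}`, `n ≥ 1`, are equidistributed. -/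
def FractEquidistributed (x : ℕ → ℝ) : Prop :=
  ∀ β : ℝ, β ∈ Icc (0 : ℝ) 1 → HasProb (fun n => Int.fract (x n) ≤ β) β

/-- The inverse of `f : [1,∞) → ℝ` (meaningful when `f` is injective on `[1,∞)`, at the values
that `f` takes there). -/
noncomputable def inv (f : ℝ → ℝ) : ℝ → ℝ := Function.invFunOn f (Ici 1)

end ZeckBenford

/-! For `n` with Zeckendorf expansion of length `t`, let y(n) = (n − F_t)/F_{t−1} ∈ [0,1) be its
relative position (`yval`). Both sides of the equivalence say that the y(K_n) have a distribution
function on [0,1] that is an increasing homeomorphism Φ of [0,1] (`HasPositionDistribution`).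

Blocks: the integers of length `t` with leading block `b` of length `s` are consecutive
(`isLeadingBlock_iff_mem_Ico`). Normalized, they fill an interval that tends, as t → ∞, to one with
left end φ(b·F̂ − 1) and length at most φω^{s−1}. So LB_s(K_n) ≤ μ|s and y(K_n) ≤ φ(μ·F̂ − 1) agree
up to errors vanishing as `n` and then `s` grow. Continuity of the distribution function absorbs
these errors, and density of the values φ(μ·F̂ − 1) (`exists_isInfExpr_mem_Ioo`) recovers Φ from
f_K^*.

Continuations: f⁻¹(n) has integer part `t`, and the t-th piece of `f` sends {f⁻¹(n)} to y(n)
(`piece_fract_inv`). If the pieces converge uniformly to Ψ, then y(K_n) = Ψ({f⁻¹(K_n)}) + o(1), so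
equidistribution gives Φ = Ψ⁻¹. Conversely, given Φ, the continuation whose pieces all equal Φ⁻¹ has
equidistributed fractional parts (`exists_continuation`). -/

namespace ZeckBenford

/-! ### Natural density -/

theorem finite_initial (P : ℕ → Prop) (n : ℕ) : {k : ℕ | 1 ≤ k ∧ k ≤ n ∧ P k}.Finite :=
  (Set.finite_Iic n).subset fun _ hk => hk.2.1

/-- If `A` eventually implies `B`, then the initial frequencies of `A` are at most those of `B`,
up to a vanishing error. -/
theorem exists_freq_le {A B : ℕ → Prop} (h : ∀ᶠ n in atTop, A n → B n) :
    ∃ e : ℕ → ℝ, Tendsto e atTop (𝓝 0) ∧ ∀ n : ℕ,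
      (Set.ncard {k : ℕ | 1 ≤ k ∧ k ≤ n ∧ A k} : ℝ) / (n : ℝ) ≤
        (Set.ncard {k : ℕ | 1 ≤ k ∧ k ≤ n ∧ B k} : ℝ) / (n : ℝ) + e n := by
  obtain ⟨N, hN⟩ := eventually_atTop.1 h
  refine ⟨fun n => ((Set.Iic N).ncard : ℝ) / n, tendsto_const_div_atTop_nhds_zero_nat _, ?_⟩
  intro n
  rw [← add_div]
  gcongr
  have h1 : {k : ℕ | 1 ≤ k ∧ k ≤ n ∧ A k} ⊆ {k : ℕ | 1 ≤ k ∧ k ≤ n ∧ B k} ∪ Set.Iic N := by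
    rintro k ⟨h1, h2, h3⟩
    by_cases hk : N ≤ k
    · exact Or.inl ⟨h1, h2, hN k hk h3⟩
    · exact Or.inr (by simp; omega)
  have h2 := Set.ncard_le_ncard h1 ((finite_initial B n).union (Set.finite_Iic N))
  exact_mod_cast h2.trans (Set.ncard_union_le _ _)

theorem HasProb.mono {A B : ℕ → Prop} {p q : ℝ} (hA : HasProb A p) (hB : HasProb B q)
    (h : ∀ᶠ n in atTop, A n → B n) : p ≤ q := by
  obtain ⟨e, he, hle⟩ := exists_freq_le h
  have := le_of_tendsto_of_tendsto' hA (Tendsto.add hB he) hle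
  simpa using this

/-- A property that can be sandwiched between properties with probabilities arbitrarily close to
`r` has probability `r`. -/
theorem hasProb_of_approx {P : ℕ → Prop} {r : ℝ}
    (hlow : ∀ ε > 0, ∃ (A : ℕ → Prop) (p : ℝ), HasProb A p ∧ r - ε < p ∧
      ∀ᶠ n in atTop, A n → P n)
    (hupp : ∀ ε > 0, ∃ (B : ℕ → Prop) (q : ℝ), HasProb B q ∧ q < r + ε ∧
      ∀ᶠ n in atTop, P n → B n) : HasProb P r := by
  refine tendsto_order.2 ⟨fun a ha => ?_, fun a ha => ?_⟩
  · obtain ⟨A, p, hA, hp, hAP⟩ := hlow (r - a) (by linarith)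
    obtain ⟨e, he, hle⟩ := exists_freq_le hAP
    have hlim := Tendsto.sub hA he
    filter_upwards [hlim.eventually (lt_mem_nhds (show a < p - 0 by linarith))] with n hn
    have := hle n
    linarith
  · obtain ⟨B, q, hB, hq, hPB⟩ := hupp (a - r) (by linarith)
    obtain ⟨e, he, hle⟩ := exists_freq_le hPB
    have hlim := Tendsto.add hB he
    filter_upwards [hlim.eventually (gt_mem_nhds (show q + 0 < a by linarith))] with n hn
    have := hle n
    linarith

theorem HasProb.congr' {A B : ℕ → Prop} {p : ℝ} (hA : HasProb A p)
    (h : ∀ᶠ n in atTop, (A n ↔ B n)) : HasProb B p :=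
  hasProb_of_approx (fun ε hε => ⟨A, p, hA, by linarith, h.mono fun _ hn => hn.1⟩)
    (fun ε hε => ⟨A, p, hA, by linarith, h.mono fun _ hn => hn.2⟩)

theorem hasProb_false : HasProb (fun _ => False) 0 := by
  unfold HasProb
  simp

theorem hasProb_true : HasProb (fun _ => True) 1 := by
  unfold HasProb
  refine tendsto_const_nhds.congr' ?_
  filter_upwards [eventually_gt_atTop 0] with n hn
  have : {k : ℕ | 1 ≤ k ∧ k ≤ n ∧ True} = (Finset.Icc 1 n : Set ℕ) := by
    ext k; simp
  rw [this, Set.ncard_coe_finset]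
  have : (n : ℝ) ≠ 0 := by positivity
  simp [this]

theorem HasProb.or {A B : ℕ → Prop} {p q : ℝ} (hA : HasProb A p) (hB : HasProb B q)
    (h : ∀ n, A n → ¬ B n) : HasProb (fun n => A n ∨ B n) (p + q) := by
  refine (Tendsto.add hA hB).congr fun n => ?_
  have h1 : {k : ℕ | 1 ≤ k ∧ k ≤ n ∧ (A k ∨ B k)} =
      {k : ℕ | 1 ≤ k ∧ k ≤ n ∧ A k} ∪ {k : ℕ | 1 ≤ k ∧ k ≤ n ∧ B k} := by
    ext k; simp only [mem_ofPred_eq, mem_union]; tauto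
  rw [h1, Set.ncard_union_eq _ (finite_initial A n) (finite_initial B n)]
  · push_cast; ring
  · exact Set.disjoint_left.2 fun k hk hk' => h k hk.2.2 hk'.2.2

theorem HasProb.and_not {A B : ℕ → Prop} {p q : ℝ} (hA : HasProb A p) (hB : HasProb B q)
    (h : ∀ n, A n → B n) : HasProb (fun n => B n ∧ ¬ A n) (q - p) := by
  refine (Tendsto.sub hB hA).congr fun n => ?_
  have h1 : {k : ℕ | 1 ≤ k ∧ k ≤ n ∧ B k} =
      {k : ℕ | 1 ≤ k ∧ k ≤ n ∧ A k} ∪ {k : ℕ | 1 ≤ k ∧ k ≤ n ∧ (B k ∧ ¬ A k)} := by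
    ext k
    have := h k
    simp only [mem_ofPred_eq, mem_union]; tauto
  rw [h1, Set.ncard_union_eq _ (finite_initial A n) (finite_initial _ n)]
  · push_cast; ring
  · exact Set.disjoint_left.2 fun k hk hk' => hk'.2.2.2 hk.2.2

theorem hasProb_exists_mem {ι : Type*} (S : Finset ι) {P : ι → ℕ → Prop} {p : ι → ℝ}
    (hP : ∀ i ∈ S, HasProb (P i) (p i)) (hd : ∀ n i j, P i n → P j n → i = j) :
    HasProb (fun n => ∃ i ∈ S, P i n) (∑ i ∈ S, p i) := by
  classical
  induction S using Finset.induction_on with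
  | empty => simpa using hasProb_false
  | insert a S ha ih =>
    rw [Finset.sum_insert ha]
    have := (hP a (Finset.mem_insert_self a S)).or
      (ih fun i hi => hP i (Finset.mem_insert_of_mem hi)) (by
        rintro n h1 ⟨j, hj, h2⟩
        exact ha (hd n a j h1 h2 ▸ hj))
    simpa using this

/-- Perturbation of a threshold event for a sequence with a continuous distribution function. -/
theorem hasProb_of_threshold {z : ℕ → ℝ} {G : ℝ → ℝ} (hG : Continuous G)
    (hz : ∀ a, HasProb (fun n => z n ≤ a) (G a)) {a : ℝ} {P : ℕ → Prop}
    (hlow : ∀ δ > 0, ∀ᶠ n in atTop, z n ≤ a - δ → P n)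
    (hupp : ∀ δ > 0, ∀ᶠ n in atTop, P n → z n ≤ a + δ) : HasProb P (G a) := by
  refine hasProb_of_approx (fun ε hε => ?_) (fun ε hε => ?_) <;>
    obtain ⟨δ, hδ, h⟩ := Metric.continuous_iff.1 hG a ε hε
  · refine ⟨_, _, hz (a - δ / 2), ?_, hlow _ (half_pos hδ)⟩
    have := h (a - δ / 2) (by rw [Real.dist_eq, abs_lt]; constructor <;> linarith)
    rw [Real.dist_eq, abs_lt] at this
    linarith
  · refine ⟨_, _, hz (a + δ / 2), ?_, hupp _ (half_pos hδ)⟩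
    have := h (a + δ / 2) (by rw [Real.dist_eq, abs_lt]; constructor <;> linarith)
    rw [Real.dist_eq, abs_lt] at this
    linarith

/-! ### Zeckendorf expansions -/

theorem F_add_two (n : ℕ) : F (n + 2) = F (n + 1) + F n := by
  simp only [F]
  rw [show n + 2 + 1 = (n + 1) + 2 from rfl, Nat.fib_add_two, add_comm]

theorem F_pos (n : ℕ) : 0 < F n := Nat.fib_pos.2 (Nat.succ_pos n)

theorem F_mono : Monotone F := fun _ _ h => Nat.fib_mono (by omega)

/-- Binary sequences without consecutive ones. -/
def IsZeck (e : ℕ → ℕ) : Prop := (∀ i, e i ≤ 1) ∧ ∀ i, e i * e (i + 1) = 0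

/-- The value of the first `t` digits, with most significant place value `F t`. -/
def zsum (e : ℕ → ℕ) (t : ℕ) : ℕ := ∑ i ∈ Finset.range t, e i * F (t - i)

theorem IsZeck.shift {e : ℕ → ℕ} (h : IsZeck e) (k : ℕ) : IsZeck fun i => e (k + i) :=
  ⟨fun _ => h.1 _, fun i => h.2 (k + i)⟩

theorem zsum_add (e : ℕ → ℕ) (s r : ℕ) :
    zsum e (s + r) = ∑ i ∈ Finset.range s, e i * F (s + r - i) + zsum (fun i => e (s + i)) r := by
  unfold zsum
  rw [Finset.sum_range_add]
  congr 1
  refine Finset.sum_congr rfl fun i _ => ?_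
  rw [Nat.add_sub_add_left]

theorem zsum_succ (e : ℕ → ℕ) (t : ℕ) :
    zsum e (t + 1) = e 0 * F (t + 1) + zsum (fun i => e (1 + i)) t := by
  rw [add_comm t 1, zsum_add]
  simp

/-- The two bounds need a joint induction: a leading 1 forces the next digit to be 0, so the rest
lies below `F t`, and `F (t + 2) = F (t + 1) + F t` closes the step. -/
theorem zsum_lt {e : ℕ → ℕ} (he : IsZeck e) (t : ℕ) :
    zsum e t < F (t + 1) ∧ (e 0 = 0 → zsum e t < F t) := by
  induction t generalizing e with
  | zero => simp [zsum, F]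
  | succ t ih =>
    rw [zsum_succ]
    have h := ih (he.shift 1)
    have h0 := he.1 0
    refine ⟨?_, fun h0 => by simpa [h0] using h.1⟩
    rw [F_add_two]
    interval_cases h00 : e 0
    · have := h.1; omega
    · have h1 : e 1 = 0 := by simpa [h00] using he.2 0
      have := h.2 (by simpa using h1)
      omega

theorem IsZeck.cons {e : ℕ → ℕ} (he : IsZeck e) {d : ℕ} (hd : d ≤ 1) (h : d * e 0 = 0) :
    IsZeck (fun i => Nat.casesOn i d e) := by
  refine ⟨fun i => ?_, fun i => ?_⟩
  · cases i with
    | zero => exact hd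
    | succ i => exact he.1 i
  · cases i with
    | zero => exact h
    | succ i => exact he.2 i

theorem zsum_cons (e : ℕ → ℕ) (d t : ℕ) :
    zsum (fun i => Nat.casesOn i d e) (t + 1) = d * F (t + 1) + zsum e t := by
  rw [zsum_succ]
  congr 2
  funext i
  rw [add_comm]

/-- Greedy choice of digits. The second clause supplies a tail that may follow a digit 1. -/
theorem exists_zsum (t : ℕ) :
    (∀ r < F (t + 1), ∃ e, IsZeck e ∧ zsum e t = r) ∧
      ∀ r < F t, ∃ e, IsZeck e ∧ zsum e t = r ∧ e 0 = 0 := by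
  induction t with
  | zero =>
    have hz : IsZeck fun _ => 0 := ⟨fun _ => Nat.zero_le _, fun _ => rfl⟩
    refine ⟨fun r hr => ⟨_, hz, ?_⟩, fun r hr => ⟨_, hz, ?_, rfl⟩⟩ <;>
      (simp [F] at hr; simp [zsum, hr])
  | succ t ih =>
    have h0 : ∀ r < F (t + 1), ∃ e, IsZeck e ∧ zsum e (t + 1) = r ∧ e 0 = 0 := by
      intro r hr
      obtain ⟨e, he, hs⟩ := ih.1 r hr
      exact ⟨_, he.cons (Nat.zero_le 1) (Nat.zero_mul _), by rw [zsum_cons]; simpa using hs, rfl⟩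
    refine ⟨fun r hr => ?_, h0⟩
    by_cases hrt : r < F (t + 1)
    · obtain ⟨e, he, hs, _⟩ := h0 r hrt
      exact ⟨e, he, hs⟩
    · rw [F_add_two] at hr
      obtain ⟨e, he, hs, he0⟩ := ih.2 (r - F (t + 1)) (by omega)
      refine ⟨_, he.cons le_rfl (by simpa using he0), ?_⟩
      rw [zsum_cons, hs]
      omega

/-- By `zsum_lt` the tail is smaller than the place value of the first digit, so the sum determines
that digit. -/
theorem zsum_inj {e e' : ℕ → ℕ} (he : IsZeck e) (he' : IsZeck e') {t : ℕ}
    (h : zsum e t = zsum e' t) : ∀ i < t, e i = e' i := by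
  induction t generalizing e e' with
  | zero => simp
  | succ t ih =>
    rw [zsum_succ, zsum_succ] at h
    have h1 := (zsum_lt (he.shift 1) t).1
    have h2 := (zsum_lt (he'.shift 1) t).1
    have h3 := he.1 0
    have h4 := he'.1 0
    have h0 : e 0 = e' 0 := by
      interval_cases e 0 <;> interval_cases e' 0 <;> omega
    rw [h0] at h
    intro i hi
    cases i with
    | zero => exact h0
    | succ i =>
      have := ih (he.shift 1) (he'.shift 1) (by omega) i (by omega)
      simpa [add_comm] using this

/-- The length of the Zeckendorf expansion of `n`. -/
def len (n : ℕ) : ℕ := Nat.greatestFib n - 1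

theorem len_spec {n : ℕ} (hn : 0 < n) : 1 ≤ len n ∧ F (len n) ≤ n ∧ n < F (len n + 1) := by
  have h2 : 2 ≤ Nat.greatestFib n := Nat.le_greatestFib.2 (by rw [Nat.fib_two]; exact hn)
  refine ⟨by unfold len; omega, ?_, ?_⟩
  · rw [F, len, Nat.sub_add_cancel (by omega)]
    exact Nat.fib_greatestFib_le n
  · rw [F, len, Nat.sub_add_cancel (by omega)]
    exact Nat.lt_fib_greatestFib_add_one n

theorem len_eq {n t : ℕ} (h2 : F t ≤ n) (h3 : n < F (t + 1)) : len n = t := by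
  obtain ⟨_, h5, h6⟩ := len_spec ((F_pos t).trans_le h2)
  rcases lt_trichotomy (len n) t with h | h | h
  · have := F_mono (show len n + 1 ≤ t from h); omega
  · exact h
  · have := F_mono (show t + 1 ≤ len n from h); omega

theorem tendsto_len : Tendsto len atTop atTop := by
  refine tendsto_atTop.2 fun b => ?_
  filter_upwards [eventually_ge_atTop (F b)] with n hn
  obtain ⟨_, _, h6⟩ := len_spec ((F_pos b).trans_le hn)
  by_contra hlt
  have := F_mono (show len n + 1 ≤ b by omega)
  omega

/-! ### Leading blocks as intervals of integers -/

/-- Extension of a finite tuple by zeros. -/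
def extend {s : ℕ} (b : Fin s → ℕ) (i : ℕ) : ℕ := if h : i < s then b ⟨i, h⟩ else 0

theorem extend_fin {s : ℕ} (b : Fin s → ℕ) (i : Fin s) : extend b i = b i := by
  simp [extend]

theorem IsCoeff.isZeck_extend {s : ℕ} {b : Fin s → ℕ} (hb : IsCoeff b) : IsZeck (extend b) := by
  refine ⟨fun i => ?_, fun i => ?_⟩
  · unfold extend
    split_ifs with h
    · exact hb.le_one _
    · exact Nat.zero_le _
  · by_cases h : i + 1 < s
    · have := hb.no_consecutive i h
      simpa [extend, h, show i < s by omega] using this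
    · simp [extend, h]

theorem IsCoeff.extend_zero {s : ℕ} {b : Fin s → ℕ} (hb : IsCoeff b) : extend b 0 = 1 := by
  have h1 := hb.head_pos
  have h2 := hb.le_one ⟨0, hb.pos⟩
  simp only [extend, hb.pos, dif_pos]
  omega

theorem isCoeff_of_isZeck {e : ℕ → ℕ} (he : IsZeck e) (h0 : e 0 = 1) {s : ℕ} (hs : 1 ≤ s)
    {b : Fin s → ℕ} (hb : ∀ i : Fin s, b i = e i) : IsCoeff b where
  pos := hs
  head_pos := by rw [hb]; simp [h0]
  le_one i := by rw [hb]; exact he.1 _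
  no_consecutive i hi := by rw [hb, hb]; exact he.2 i

theorem conv_eq_zsum {s : ℕ} (b : Fin s → ℕ) : conv b F = zsum (extend b) s := by
  rw [zsum, Finset.sum_range, conv]
  simp [extend_fin]

theorem isLeadingBlock_iff {s n : ℕ} {b : Fin s → ℕ} : IsLeadingBlock s n b ↔
    ∃ (t : ℕ) (e : ℕ → ℕ), s ≤ t ∧ 1 ≤ t ∧ IsZeck e ∧ e 0 = 1 ∧ n = zsum e t ∧
      ∀ i : Fin s, b i = e i := by
  constructor
  · rintro ⟨t, hst, ε, hε, hn, hb⟩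
    refine ⟨t, extend ε, hst, hε.pos, hε.isZeck_extend, hε.extend_zero, hn.trans (conv_eq_zsum ε),
      fun i => ?_⟩
    rw [hb, ← extend_fin ε]
    rfl
  · rintro ⟨t, e, hst, ht, he, h0, hn, hb⟩
    refine ⟨t, hst, fun i => e i, isCoeff_of_isZeck he h0 ht fun _ => rfl, ?_, hb⟩
    rw [hn, conv, zsum, Finset.sum_range]

theorem len_zsum {e : ℕ → ℕ} (he : IsZeck e) (h0 : e 0 = 1) {t : ℕ} (ht : 1 ≤ t) :
    len (zsum e t) = t := by
  refine len_eq ?_ (zsum_lt he t).1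
  obtain ⟨m, rfl⟩ := Nat.exists_eq_add_of_le' ht
  rw [zsum_succ, h0]
  omega

theorem isLeadingBlock_iff_len {s n : ℕ} {b : Fin s → ℕ} : IsLeadingBlock s n b ↔
    ∃ e : ℕ → ℕ, s ≤ len n ∧ 1 ≤ len n ∧ IsZeck e ∧ e 0 = 1 ∧ n = zsum e (len n) ∧
      ∀ i : Fin s, b i = e i := by
  rw [isLeadingBlock_iff]
  constructor
  · rintro ⟨t, e, hst, ht, he, h0, hn, hb⟩
    have : len n = t := hn ▸ len_zsum he h0 ht
    exact ⟨e, this.symm ▸ hst, this.symm ▸ ht, he, h0, this.symm ▸ hn, hb⟩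
  · rintro ⟨e, h⟩
    exact ⟨len n, e, h⟩

theorem exists_isLeadingBlock {s n : ℕ} (hn : 0 < n) (hs : s ≤ len n) :
    ∃ b : Fin s → ℕ, IsLeadingBlock s n b := by
  obtain ⟨h1, h2, h3⟩ := len_spec hn
  obtain ⟨e, he, hsum⟩ := (exists_zsum (len n)).1 n h3
  refine ⟨fun i => e i, isLeadingBlock_iff_len.2 ⟨e, hs, h1, he, ?_, hsum.symm, fun _ => rfl⟩⟩
  have h4 := he.1 0
  by_contra h5
  have := (zsum_lt he (len n)).2 (by omega)
  omega

theorem IsLeadingBlock.isCoeff {s n : ℕ} {b : Fin s → ℕ} (h : IsLeadingBlock s n b)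
    (hs : 1 ≤ s) : IsCoeff b := by
  obtain ⟨t, e, -, -, he, h0, -, hb⟩ := isLeadingBlock_iff.1 h
  exact isCoeff_of_isZeck he h0 hs hb

theorem IsLeadingBlock.unique {s n : ℕ} {b c : Fin s → ℕ} (hb : IsLeadingBlock s n b)
    (hc : IsLeadingBlock s n c) : b = c := by
  obtain ⟨e, hs, -, he, -, hn, hb⟩ := isLeadingBlock_iff_len.1 hb
  obtain ⟨e', -, -, he', -, hn', hc⟩ := isLeadingBlock_iff_len.1 hc
  funext i
  rw [hb, hc]
  exact zsum_inj he he' (hn.symm.trans hn') i (i.2.trans_le hs)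

/-- The least integer with expansion of length `t` and leading block `b`. -/
def blockMin {s : ℕ} (b : Fin s → ℕ) (t : ℕ) : ℕ := ∑ i : Fin s, b i * F (t - i)

theorem blockMin_eq {s : ℕ} (b : Fin s → ℕ) (t : ℕ) {e : ℕ → ℕ} (hb : ∀ i : Fin s, b i = e i) :
    blockMin b t = ∑ i ∈ Finset.range s, e i * F (t - i) := by
  rw [Finset.sum_range, blockMin]
  simp [hb]

/-- The tail after a block contributes `0, 1, …, F (t - s + 1 - d) - 1`, where `d` is the last digit
of the block. -/
theorem isLeadingBlock_iff_mem_Ico {s n : ℕ} {b : Fin s → ℕ} (hb : IsCoeff b) (hn : 0 < n)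
    (hs : s ≤ len n) : IsLeadingBlock s n b ↔
      blockMin b (len n) ≤ n ∧
        n < blockMin b (len n) + F (len n - s + 1 - extend b (s - 1)) := by
  have hs1 : 1 ≤ s := hb.pos
  obtain ⟨r, hr⟩ := Nat.exists_eq_add_of_le hs
  have hz := hb.isZeck_extend
  constructor
  · intro h
    obtain ⟨e, -, ht, he, h0, hsum, hbe⟩ := isLeadingBlock_iff_len.1 h
    have hlast : extend b (s - 1) = e (s - 1) := by
      have := hbe ⟨s - 1, by omega⟩
      simpa [extend, hb.pos] using this
    have hn' : n = blockMin b (len n) + zsum (fun i => e (s + i)) r := by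
      conv_lhs => rw [hsum, hr, zsum_add]
      rw [blockMin_eq b _ hbe, hr]
    have hlt := zsum_lt (he.shift s) r
    refine ⟨by omega, ?_⟩
    have hle := he.1 (s - 1)
    rw [hlast, show len n - s = r by omega]
    have : zsum (fun i => e (s + i)) r < F (r + 1 - e (s - 1)) := by
      interval_cases h1 : e (s - 1)
      · exact hlt.1
      · refine hlt.2 ?_
        have := he.2 (s - 1)
        rw [h1, Nat.sub_add_cancel hs1] at this
        simpa using this
    omega
  · rintro ⟨h1, h2⟩
    obtain ⟨e', he', hsum, hj⟩ : ∃ e', IsZeck e' ∧ zsum e' r = n - blockMin b (len n) ∧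
        extend b (s - 1) * e' 0 = 0 := by
      have hle := hz.1 (s - 1)
      rw [show len n - s = r by omega] at h2
      interval_cases h3 : extend b (s - 1)
      · obtain ⟨e', he', hsum⟩ := (exists_zsum r).1 (n - blockMin b (len n)) (by
          simp only [Nat.sub_zero] at h2; omega)
        exact ⟨e', he', hsum, by simp⟩
      · obtain ⟨e', he', hsum, h0⟩ := (exists_zsum r).2 (n - blockMin b (len n)) (by
          simp only [Nat.add_sub_cancel] at h2; omega)
        exact ⟨e', he', hsum, by simp [h0]⟩
    -- The expansion of `n` is the block followed by the tail `e'`; `hj` rules out two ones at the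
    -- joint.
    have hbe : ∀ i : Fin s, b i = (fun i => if i < s then extend b i else e' (i - s)) i := by
      intro i
      simp [extend_fin]
    refine isLeadingBlock_iff_len.2 ⟨fun i => if i < s then extend b i else e' (i - s), hs,
      (len_spec hn).1, ⟨fun i => ?_, fun i => ?_⟩, ?_, ?_, hbe⟩
    · dsimp only
      split_ifs
      · exact hz.1 i
      · exact he'.1 _
    · dsimp only
      by_cases h3 : i + 1 < s
      · simpa [h3, show i < s by omega] using hz.2 i
      · by_cases h4 : i < s
        · obtain rfl : i = s - 1 := by omega
          simpa [h4, show s - 1 + 1 = s by omega] using hj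
        · have := he'.2 (i - s)
          simpa [h3, h4, show i + 1 - s = i - s + 1 by omega] using this
    · simp [hb.extend_zero, hb.pos]
    · conv_rhs => rw [hr, zsum_add]
      rw [blockMin_eq b _ (e := fun i => if i < s then extend b i else e' (i - s)) hbe, hr]
        at hsum h1
      have : (fun i => (fun i => if i < s then extend b i else e' (i - s)) (s + i)) = e' := by
        funext i; simp
      rw [this, hsum]
      omega

/-! ### Relative positions and their asymptotics -/

theorem omega_pos : 0 < omega := inv_pos.2 Real.goldenRatio_pos

theorem omega_lt_one : omega < 1 := inv_lt_one_of_one_lt₀ Real.one_lt_goldenRatio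

theorem F_cast_pos (n : ℕ) : (0 : ℝ) < F n := by exact_mod_cast F_pos n

theorem tendsto_F_ratio (j : ℕ) :
    Tendsto (fun t => (F (t - j) : ℝ) / F (t - 1)) atTop (𝓝 (Real.goldenRatio * omega ^ j)) := by
  have hφ := Real.goldenRatio_pos.ne'
  have h0 : Tendsto (fun t => (F (t + 1) : ℝ) / F t) atTop (𝓝 Real.goldenRatio) :=
    tendsto_fib_succ_div_fib_atTop.comp (tendsto_add_atTop_nat 1)
  have h1 : ∀ i, Tendsto (fun t => (F (t - i) : ℝ) / F (t - (i + 1))) atTop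
      (𝓝 Real.goldenRatio) := by
    intro i
    refine (h0.comp (tendsto_sub_atTop_nat (i + 1))).congr' ?_
    filter_upwards [eventually_ge_atTop (i + 1)] with t ht
    simp only [Function.comp, show t - (i + 1) + 1 = t - i by omega]
  induction j with
  | zero => simpa using h1 0
  | succ j ih =>
    have := ih.div (h1 j) hφ
    have h2 : Real.goldenRatio * omega ^ j / Real.goldenRatio =
        Real.goldenRatio * omega ^ (j + 1) := by
      rw [pow_succ, omega, div_eq_mul_inv]; ring
    rw [h2] at this
    refine this.congr fun t => ?_
    have := (F_cast_pos (t - j)).ne'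
    simp only [Pi.div_apply]
    field_simp

theorem tendsto_F_atTop : Tendsto (fun t => (F (t - 1) : ℝ)) atTop atTop := by
  refine tendsto_natCast_atTop_atTop.comp ?_
  refine (?_ : Tendsto F atTop atTop).comp (tendsto_sub_atTop_nat 1)
  have h : ∀ n, n + 1 ≤ F (n + 2) := by
    intro n
    induction n with
    | zero => decide
    | succ n ih =>
      have : F (n + 1 + 2) = F (n + 2) + F (n + 1) := F_add_two (n + 1)
      have := F_pos (n + 1)
      omega
  exact (tendsto_add_atTop_iff_nat 2).1 <|
    tendsto_atTop_mono (fun n => (Nat.le_succ n).trans (h n)) tendsto_id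

/-- The relative position of `n` between the consecutive Fibonacci numbers around it. -/
noncomputable def yval (n : ℕ) : ℝ := ((n : ℝ) - F (len n)) / F (len n - 1)

theorem F_len_succ {t : ℕ} (ht : 1 ≤ t) : (F (t + 1) : ℝ) = F t + F (t - 1) := by
  obtain ⟨m, rfl⟩ := Nat.exists_eq_add_of_le' ht
  rw [F_add_two]
  push_cast
  rfl

theorem yval_nonneg {n : ℕ} (hn : 0 < n) : 0 ≤ yval n := by
  obtain ⟨_, h2, _⟩ := len_spec hn
  have : (F (len n) : ℝ) ≤ n := by exact_mod_cast h2
  exact div_nonneg (by linarith) (F_cast_pos _).le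

theorem yval_lt_one {n : ℕ} (hn : 0 < n) : yval n < 1 := by
  obtain ⟨h1, _, h3⟩ := len_spec hn
  have : (n : ℝ) < F (len n + 1) := by exact_mod_cast h3
  rw [F_len_succ h1] at this
  rw [yval, div_lt_one (F_cast_pos _)]
  linarith

/-- Error bound for the normalization of all blocks of length `s`. -/
noncomputable def blockErr (s t : ℕ) : ℝ :=
  ∑ i : Fin s, |(F (t - i) : ℝ) / F (t - 1) - Real.goldenRatio * omega ^ (i : ℕ)| +
    |(F (t - 0) : ℝ) / F (t - 1) - Real.goldenRatio * omega ^ 0| +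
    |(F (t - (s - 1)) : ℝ) / F (t - 1) - Real.goldenRatio * omega ^ (s - 1)|

theorem tendsto_blockErr (s : ℕ) : Tendsto (blockErr s) atTop (𝓝 0) := by
  have h : ∀ j, Tendsto
      (fun t => |(F (t - j) : ℝ) / F (t - 1) - Real.goldenRatio * omega ^ j|) atTop (𝓝 0) := by
    intro j
    simpa using ((tendsto_F_ratio j).sub_const (Real.goldenRatio * omega ^ j)).abs
  have := ((tendsto_finsetSum Finset.univ fun (i : Fin s) _ => h i).add (h 0)).add (h (s - 1))
  simp only [add_zero, Finset.sum_const_zero] at this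
  exact this

/-- The bound does not depend on `b`, so it applies to the leading block of `n` as `n` varies. The
subtracted summand of `blockErr` is kept in reserve for the length of the tail interval. -/
theorem abs_blockMin_sub_le {s : ℕ} {b : Fin s → ℕ} (hb : ∀ i, b i ≤ 1) (t : ℕ) :
    |((blockMin b t : ℝ) - F t) / F (t - 1) - Real.goldenRatio * (dotHat b - 1)| ≤
      blockErr s t - |(F (t - (s - 1)) : ℝ) / F (t - 1) - Real.goldenRatio * omega ^ (s - 1)| := by
  have h1 : ((blockMin b t : ℝ) - F t) / F (t - 1) - Real.goldenRatio * (dotHat b - 1) =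
      ∑ i : Fin s, (b i : ℝ) * ((F (t - i) : ℝ) / F (t - 1) -
        Real.goldenRatio * omega ^ (i : ℕ)) -
      ((F (t - 0) : ℝ) / F (t - 1) - Real.goldenRatio * omega ^ 0) := by
    simp only [mul_sub, Finset.sum_sub_distrib, blockMin, dotHat, Nat.cast_sum, Nat.cast_mul,
      Finset.mul_sum, sub_div, Finset.sum_div, mul_div_assoc]
    have : ∀ i : Fin s, (b i : ℝ) * (Real.goldenRatio * omega ^ (i : ℕ)) =
        Real.goldenRatio * ((b i : ℝ) * omega ^ (i : ℕ)) := fun i => by ring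
    simp only [this, Nat.sub_zero, pow_zero]
    ring
  rw [h1, blockErr, add_sub_cancel_right]
  refine (abs_sub _ _).trans (add_le_add_left ((Finset.abs_sum_le_sum_abs _ _).trans
    (Finset.sum_le_sum fun i _ => ?_)) _)
  rw [abs_mul]
  refine mul_le_of_le_one_left (abs_nonneg _) ?_
  rw [Nat.abs_cast]
  exact_mod_cast hb i

theorem tendsto_blockMin {s : ℕ} {b : Fin s → ℕ} (hb : ∀ i, b i ≤ 1) :
    Tendsto (fun t => ((blockMin b t : ℝ) - F t) / F (t - 1)) atTop
      (𝓝 (Real.goldenRatio * (dotHat b - 1))) := by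
  rw [tendsto_iff_dist_tendsto_zero]
  refine squeeze_zero (fun _ => dist_nonneg) (fun t => ?_) (tendsto_blockErr s)
  rw [Real.dist_eq]
  exact (abs_blockMin_sub_le hb t).trans (sub_le_self _ (abs_nonneg _))

theorem IsLeadingBlock.yval_bounds {s n : ℕ} {b : Fin s → ℕ} (h : IsLeadingBlock s n b)
    (hs : 1 ≤ s) (hn : 0 < n) :
    Real.goldenRatio * (dotHat b - 1) - blockErr s (len n) ≤ yval n ∧
      yval n ≤ Real.goldenRatio * (dotHat b - 1) + Real.goldenRatio * omega ^ (s - 1) +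
        blockErr s (len n) := by
  have hb := h.isCoeff hs
  obtain ⟨_, hsn, -⟩ := isLeadingBlock_iff_len.1 h
  obtain ⟨h1, h2⟩ := (isLeadingBlock_iff_mem_Ico hb hn hsn).1 h
  -- Dropping the last digit gives one width, of limit φω^{s−1}, valid for all blocks.
  have h3 : F (len n - s + 1 - extend b (s - 1)) ≤ F (len n - (s - 1)) := F_mono (by omega)
  have h4 := abs_le.1 (abs_blockMin_sub_le hb.le_one (len n))
  have h5 := abs_nonneg
    ((F (len n - (s - 1)) : ℝ) / F (len n - 1) - Real.goldenRatio * omega ^ (s - 1))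
  have h6 := le_abs_self
    ((F (len n - (s - 1)) : ℝ) / F (len n - 1) - Real.goldenRatio * omega ^ (s - 1))
  have hF := F_cast_pos (len n - 1)
  have h7 : ((blockMin b (len n) : ℝ) - F (len n)) / F (len n - 1) ≤ yval n := by
    unfold yval
    have : (blockMin b (len n) : ℝ) ≤ n := by exact_mod_cast h1
    gcongr
  have h8 : yval n ≤ ((blockMin b (len n) : ℝ) - F (len n)) / F (len n - 1) +
      (F (len n - (s - 1)) : ℝ) / F (len n - 1) := by
    rw [← add_div, yval]
    have : (n : ℝ) ≤ blockMin b (len n) + F (len n - (s - 1)) := by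
      exact_mod_cast h2.le.trans (by omega)
    gcongr
    linarith
  constructor <;> linarith

/-- Blocks are compared through the left ends of their intervals, so only the vanishing error is
lost here; the converse `eventually_of_LBLE` also loses the interval width. -/
theorem eventually_LBLE {s : ℕ} (hs : 1 ≤ s) (c : Fin s → ℕ) {δ : ℝ} (hδ : 0 < δ) :
    ∀ᶠ n in atTop, yval n ≤ Real.goldenRatio * (dotHat c - 1) - δ → LBLE s n c := by
  filter_upwards [eventually_gt_atTop 0, tendsto_len.eventually_ge_atTop s,
    ((tendsto_blockErr s).comp tendsto_len).eventually (gt_mem_nhds hδ)] with n hn hsn he hy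
  obtain ⟨b, hb⟩ := exists_isLeadingBlock hn hsn
  refine ⟨b, hb, Or.inr ?_⟩
  have := (hb.yval_bounds hs hn).1
  simp only [Function.comp] at he
  have h2 : Real.goldenRatio * (dotHat b - 1) < Real.goldenRatio * (dotHat c - 1) := by linarith
  have := (mul_lt_mul_iff_right₀ Real.goldenRatio_pos).1 h2
  linarith

theorem eventually_of_LBLE {s : ℕ} (hs : 1 ≤ s) (c : Fin s → ℕ) {δ : ℝ} (hδ : 0 < δ) :
    ∀ᶠ n in atTop, LBLE s n c → yval n ≤
      Real.goldenRatio * (dotHat c - 1) + Real.goldenRatio * omega ^ (s - 1) + δ := by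
  filter_upwards [eventually_gt_atTop 0,
    ((tendsto_blockErr s).comp tendsto_len).eventually (gt_mem_nhds hδ)] with n hn he
  rintro ⟨b, hb, hbc⟩
  have := (hb.yval_bounds hs hn).2
  simp only [Function.comp] at he
  have h1 : dotHat b ≤ dotHat c := by
    rcases hbc with rfl | h
    · exact le_rfl
    · exact h.le
  have := mul_le_mul_of_nonneg_left (sub_le_sub_right h1 1) Real.goldenRatio_pos.le
  linarith

theorem tendsto_goldenRatio_mul_omega_pow :
    Tendsto (fun s : ℕ => Real.goldenRatio * omega ^ (s - 1)) atTop (𝓝 0) := by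
  simpa using ((tendsto_pow_atTop_nhds_zero_of_lt_one omega_pos.le omega_lt_one).comp
    (tendsto_sub_atTop_nat 1)).const_mul Real.goldenRatio

theorem tendsto_dotHat_trunc {μ : ℕ → ℕ} (hμ : ∀ k, μ k ≤ 1) :
    Tendsto (fun s => dotHat (trunc μ s)) atTop (𝓝 (infDotHat μ)) := by
  have hsum : Summable fun k => (μ k : ℝ) * omega ^ k := by
    refine Summable.of_nonneg_of_le (fun k => by have := omega_pos; positivity) (fun k => ?_)
      (summable_geometric_of_lt_one omega_pos.le omega_lt_one)
    refine mul_le_of_le_one_left (pow_nonneg omega_pos.le k) ?_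
    exact_mod_cast hμ k
  refine hsum.tendsto_sum_tsum_nat.congr fun s => ?_
  rw [Finset.sum_range]
  rfl

theorem infDotHat_extend {s : ℕ} (b : Fin s → ℕ) : infDotHat (extend b) = dotHat b := by
  rw [infDotHat, tsum_eq_sum (s := Finset.range s), Finset.sum_range, dotHat]
  · simp [extend_fin]
  · intro k hk
    have : ¬ k < s := by simpa using hk
    simp [extend, this]

theorem IsCoeff.isInfExpr_extend {s : ℕ} {b : Fin s → ℕ} (hb : IsCoeff b) :
    IsInfExpr (extend b) where
  le_one := hb.isZeck_extend.1
  no_consecutive := hb.isZeck_extend.2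
  tail_ne j h := by
    have := congrFun h (2 * s)
    simp [extend, show ¬ j + 2 * s < s by omega] at this

/-- The values of the infinite expressions are dense. -/
theorem exists_isInfExpr_mem_Ioo {a b : ℝ} (ha : 0 ≤ a) (hab : a < b) (hb : b ≤ 1) :
    ∃ μ, IsInfExpr μ ∧ μ 0 = 1 ∧ Real.goldenRatio * (infDotHat μ - 1) ∈ Ioo a b := by
  set m := (a + b) / 2 with hm
  set η := (b - a) / 8 with hη
  have hη0 : 0 < η := by linarith
  obtain ⟨s, hs, hsη⟩ := ((eventually_ge_atTop 1).and
    (tendsto_goldenRatio_mul_omega_pow.eventually (gt_mem_nhds hη0))).exists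
  obtain ⟨t, ht, hterr, hF⟩ := ((eventually_ge_atTop s).and
    (((tendsto_blockErr s).eventually (gt_mem_nhds hη0)).and
      (tendsto_F_atTop.eventually_gt_atTop η⁻¹))).exists
  -- The integer `F t + r` lies within η of the midpoint `m` in relative position; its leading
  -- block, padded by zeros, is the required expression. Rounding, block width and `blockErr` cost
  -- less than 3η in total, and `a`, `b` are at distance 4η from `m`.
  have hFpos := F_cast_pos (t - 1)
  set r := ⌊m * F (t - 1)⌋₊ with hr
  have hr1 : (r : ℝ) ≤ m * F (t - 1) := Nat.floor_le (by have : 0 ≤ m := by linarith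
                                                         positivity)
  have hr2 : m * F (t - 1) < r + 1 := Nat.lt_floor_add_one _
  have hrlt : r < F (t - 1) := by
    have : (r : ℝ) < F (t - 1) := hr1.trans_lt (mul_lt_of_lt_one_left hFpos (by linarith))
    exact_mod_cast this
  have hlen : len (F t + r) = t := by
    refine len_eq (by omega) ?_
    obtain ⟨k, rfl⟩ := Nat.exists_eq_add_of_le' (hs.trans ht)
    rw [F_add_two]
    simp only [Nat.add_sub_cancel] at hrlt
    omega
  have hn : 0 < F t + r := Nat.add_pos_left (F_pos t) r
  have hy : yval (F t + r) = r / F (t - 1) := by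
    rw [yval, hlen]; push_cast; congr 1; ring
  have hy1 : yval (F t + r) ≤ m := by rw [hy, div_le_iff₀ hFpos]; exact hr1
  have hy2 : m - η < yval (F t + r) := by
    rw [hy, lt_div_iff₀ hFpos]
    have : 1 < η * F (t - 1) := by
      rw [inv_lt_iff_one_lt_mul₀ hη0] at hF
      linarith
    linarith
  obtain ⟨c, hc⟩ := exists_isLeadingBlock hn (hlen.symm ▸ ht)
  have hcc := hc.isCoeff hs
  have hbd := hc.yval_bounds hs hn
  rw [hlen] at hbd
  refine ⟨extend c, hcc.isInfExpr_extend, hcc.extend_zero, ?_⟩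
  rw [infDotHat_extend]
  constructor <;> linarith [hbd.1, hbd.2]

/-! ### Distribution functions of relative positions -/

/-- Perturbed thresholds may leave [0,1], so `hasProb_of_threshold` needs a continuous distribution
function on the whole line. -/
theorem hasProb_clamp {z : ℕ → ℝ} (hz : ∀ᶠ n in atTop, z n ∈ Ico (0 : ℝ) 1) {Φ : ℝ ≃o ℝ}
    (h0 : Φ 0 = 0) (h1 : Φ 1 = 1)
    (h : ∀ a ∈ Icc (0 : ℝ) 1, HasProb (fun n => z n ≤ a) (Φ a)) (a : ℝ) :
    HasProb (fun n => z n ≤ a) (max 0 (min 1 (Φ a))) := by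
  rcases lt_or_ge a 0 with ha | ha
  · have : Φ a < 0 := h0 ▸ Φ.strictMono ha
    rw [max_eq_left ((min_le_right _ _).trans this.le)]
    refine hasProb_false.congr' ?_
    filter_upwards [hz] with n hn
    simpa using ha.trans_le hn.1
  · have h2 : 0 ≤ Φ a := h0 ▸ Φ.monotone ha
    rcases le_or_gt a 1 with hb | hb
    · have h3 : Φ a ≤ 1 := h1 ▸ Φ.monotone hb
      rw [min_eq_right h3, max_eq_right h2]
      exact h a ⟨ha, hb⟩
    · have h3 : 1 ≤ Φ a := h1 ▸ Φ.monotone hb.le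
      rw [min_eq_left h3, max_eq_right zero_le_one]
      refine hasProb_true.congr' ?_
      filter_upwards [hz] with n hn
      simpa using hn.2.le.trans hb.le

theorem clamp_eq {Φ : ℝ ≃o ℝ} (h0 : Φ 0 = 0) (h1 : Φ 1 = 1) {a : ℝ} (ha : a ∈ Icc (0 : ℝ) 1) :
    max 0 (min 1 (Φ a)) = Φ a := by
  rw [min_eq_right (h1 ▸ Φ.monotone ha.2), max_eq_right (h0 ▸ Φ.monotone ha.1)]

/-- An increasing homeomorphism of the unit interval extends to one of the line. -/
theorem exists_orderIso_extension {h : ℝ → ℝ} (hc : ContinuousOn h (Icc 0 1))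
    (hm : StrictMonoOn h (Icc 0 1)) (h0 : h 0 = 0) (h1 : h 1 = 1) :
    ∃ Φ : ℝ ≃o ℝ, ∀ x ∈ Icc (0 : ℝ) 1, Φ x = h x := by
  classical
  set H : ℝ → ℝ := fun x => if x ∈ Icc (0 : ℝ) 1 then h x else x with hH
  have hin : ∀ x ∈ Icc (0 : ℝ) 1, H x = h x := fun x hx => if_pos hx
  have hout : ∀ x ∉ Icc (0 : ℝ) 1, H x = x := fun x hx => if_neg hx
  have hmaps : ∀ x ∈ Icc (0 : ℝ) 1, h x ∈ Icc (0 : ℝ) 1 := fun x hx =>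
    ⟨h0 ▸ hm.monotoneOn (by simp) hx hx.1, h1 ▸ hm.monotoneOn hx (by simp) hx.2⟩
  have hmono : StrictMono H := by
    intro x y hxy
    by_cases hx : x ∈ Icc (0 : ℝ) 1 <;> by_cases hy : y ∈ Icc (0 : ℝ) 1
    · rw [hin x hx, hin y hy]; exact hm hx hy hxy
    · rw [hin x hx, hout y hy]
      by_contra hle
      exact hy ⟨hx.1.trans hxy.le, (not_lt.1 hle).trans (hmaps x hx).2⟩
    · rw [hout x hx, hin y hy]
      by_contra hle
      exact hx ⟨(hmaps y hy).1.trans (not_lt.1 hle), hxy.le.trans hy.2⟩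
    · rw [hout x hx, hout y hy]; exact hxy
  have hsurj : Function.Surjective H := by
    intro y
    by_cases hy : y ∈ Icc (0 : ℝ) 1
    · have := intermediate_value_Icc zero_le_one hc
      rw [h0, h1] at this
      obtain ⟨x, hx, rfl⟩ := this hy
      exact ⟨x, hin x hx⟩
    · exact ⟨y, hout y hy⟩
  exact ⟨hmono.orderIsoOfSurjective H hsurj, fun x hx => hin x hx⟩

/-- The relative positions of the terms of `K` have distribution function `Φ` on `[0,1]`. -/
structure HasPositionDistribution (K : ℕ → ℕ) (Φ : ℝ ≃o ℝ) : Prop where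
  map_zero : Φ 0 = 0
  map_one : Φ 1 = 1
  hasProb : ∀ a ∈ Icc (0 : ℝ) 1, HasProb (fun n => yval (K n) ≤ a) (Φ a)

theorem HasStrongLeadingBlockDistribution.exists_hasProb_LBLE {K : ℕ → ℕ}
    (h : HasStrongLeadingBlockDistribution K) {s : ℕ} (hs : 2 ≤ s) (c : Fin s → ℕ) :
    ∃ q, HasProb (fun n => LBLE s (K n) c) q := by
  classical
  have h1 : ∀ b : Fin s → ℕ, ∃ p, IsCoeff b → HasProb (fun n => IsLeadingBlock s (K n) b) p := by
    intro b
    by_cases hb : IsCoeff b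
    · obtain ⟨p, hp⟩ := h s hs b hb
      exact ⟨p, fun _ => hp⟩
    · exact ⟨0, fun hb' => absurd hb' hb⟩
  choose p hp using h1
  have h2 := hasProb_exists_mem
    ((Fintype.piFinset fun _ : Fin s => Finset.range 2).filter fun b => IsCoeff b ∧ BlockLE b c)
    (P := fun b n => IsLeadingBlock s (K n) b) (p := p)
    (fun b hb => hp b (Finset.mem_filter.1 hb).2.1) (fun n b b' hb hb' => hb.unique hb')
  refine ⟨_, h2.congr' (Eventually.of_forall fun n => ⟨?_, ?_⟩)⟩
  · rintro ⟨b, hb, hbn⟩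
    exact ⟨b, hbn, (Finset.mem_filter.1 hb).2.2⟩
  · rintro ⟨b, hbn, hbc⟩
    have hb := hbn.isCoeff (by omega)
    refine ⟨b, Finset.mem_filter.2 ⟨?_, hb, hbc⟩, hbn⟩
    rw [Fintype.mem_piFinset]
    exact fun i => Finset.mem_range.2 (Nat.lt_succ_of_le (hb.le_one i))

theorem eventually_yval_mem {K : ℕ → ℕ} (hpos : ∀ n : ℕ, 1 ≤ n → 0 < K n) : ∀ᶠ n in atTop, yval (K n) ∈ Ico (0 : ℝ) 1 := by
  filter_upwards [eventually_ge_atTop 1] with n hn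
  exact ⟨yval_nonneg (hpos n hn), yval_lt_one (hpos n hn)⟩

/-! ### From position distribution to leading blocks -/

/-- After normalization this is a threshold event for `yval` whose threshold moves with the length
and tends to `u`; continuity of Φ allows the replacement by `u`. It is applied to both ends of a
block interval. -/
theorem HasPositionDistribution.hasProb_lt {K : ℕ → ℕ}
    (hpos : ∀ n : ℕ, 1 ≤ n → 0 < K n) (hK : Tendsto K atTop atTop) {Φ : ℝ ≃o ℝ}
    (h : HasPositionDistribution K Φ) {V : ℕ → ℕ} {u : ℝ}
    (hV : Tendsto (fun t => ((V t : ℝ) - F t) / F (t - 1)) atTop (𝓝 u)) :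
    HasProb (fun n => K n < V (len (K n))) (max 0 (min 1 (Φ u))) := by
  have hlen := hV.comp (tendsto_len.comp hK)
  have hlt : ∀ n, K n < V (len (K n)) ↔
      yval (K n) < ((V (len (K n)) : ℝ) - F (len (K n))) / F (len (K n) - 1) := by
    intro n
    rw [yval, div_lt_div_iff_of_pos_right (F_cast_pos _), sub_lt_sub_iff_right, Nat.cast_lt]
  refine hasProb_of_threshold (G := fun u => max 0 (min 1 (Φ u)))
    (continuous_const.max (continuous_const.min Φ.continuous))
    (hasProb_clamp (eventually_yval_mem hpos) h.map_zero h.map_one h.hasProb)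
    (fun δ hδ => ?_) (fun δ hδ => ?_)
  · filter_upwards [hlen.eventually (lt_mem_nhds (sub_lt_self u hδ))] with n hn hy
    exact (hlt n).2 (hy.trans_lt hn)
  · filter_upwards [hlen.eventually (gt_mem_nhds (lt_add_of_pos_right u hδ))] with n hn hy
    exact ((hlt n).1 hy).le.trans hn.le

theorem HasPositionDistribution.strong {K : ℕ → ℕ}
    (hpos : ∀ n : ℕ, 1 ≤ n → 0 < K n) (hK : Tendsto K atTop atTop) {Φ : ℝ ≃o ℝ}
    (h : HasPositionDistribution K Φ) :
    HasStrongLeadingBlockDistribution K := by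
  intro s hs b hb
  have hV := tendsto_blockMin hb.le_one
  have hd := hb.isZeck_extend.1 (s - 1)
  have hW : Tendsto (fun t => (((blockMin b t + F (t - s + 1 - extend b (s - 1)) : ℕ) : ℝ) - F t) /
      F (t - 1)) atTop (𝓝 (Real.goldenRatio * (dotHat b - 1) +
        Real.goldenRatio * omega ^ (s - 1 + extend b (s - 1)))) := by
    refine (hV.add (tendsto_F_ratio (s - 1 + extend b (s - 1)))).congr' ?_
    filter_upwards [eventually_ge_atTop s] with t ht
    rw [show t - s + 1 - extend b (s - 1) = t - (s - 1 + extend b (s - 1)) by omega]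
    push_cast
    ring
  refine ⟨_, ((h.hasProb_lt hpos hK hV).and_not (h.hasProb_lt hpos hK hW)
    fun n hn => hn.trans_le (Nat.le_add_right _ _)).congr' ?_⟩
  filter_upwards [eventually_ge_atTop 1, (tendsto_len.comp hK).eventually_ge_atTop s] with n hn hsn
  rw [isLeadingBlock_iff_mem_Ico hb (hpos n hn) hsn, not_lt, and_comm]

theorem HasPositionDistribution.continuousLeadingBlock {K : ℕ → ℕ}
    (hpos : ∀ n : ℕ, 1 ≤ n → 0 < K n) (hK : Tendsto K atTop atTop) {Φ : ℝ ≃o ℝ}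
    (h : HasPositionDistribution K Φ) :
    HasContinuousLeadingBlockDistribution K := by
  set G : ℝ → ℝ := fun a => max 0 (min 1 (Φ a)) with hG
  have hGc : Continuous G := continuous_const.max (continuous_const.min Φ.continuous)
  have hGp := hasProb_clamp (eventually_yval_mem hpos) h.map_zero h.map_one h.hasProb
  have hGe : ∀ a ∈ Icc (0 : ℝ) 1, G a = Φ a := fun a ha => clamp_eq h.map_zero h.map_one ha
  have hst := h.strong hpos hK
  refine ⟨hst, G, ?_, ?_, fun μ hμ _ => ?_, hGc.continuousOn, ?_⟩
  · rw [hGe 0 (by simp), h.map_zero]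
  · rw [hGe 1 (by simp), h.map_one]
  · have hex : ∀ s, ∃ q, 2 ≤ s → HasProb (fun n => LBLE s (K n) (trunc μ s)) q := by
      intro s
      by_cases hs : 2 ≤ s
      · obtain ⟨q, hq⟩ := hst.exists_hasProb_LBLE hs (trunc μ s)
        exact ⟨q, fun _ => hq⟩
      · exact ⟨0, fun h => absurd h hs⟩
    choose q hq using hex
    refine ⟨q, hq, ?_⟩
    have hu : Tendsto (fun s => Real.goldenRatio * (dotHat (trunc μ s) - 1)) atTop
        (𝓝 (Real.goldenRatio * (infDotHat μ - 1))) :=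
      ((tendsto_dotHat_trunc hμ.le_one).sub_const 1).const_mul _
    have hv := hu.add tendsto_goldenRatio_mul_omega_pow
    rw [add_zero] at hv
    -- Squeeze: with u_s = φ(μ|s · F̂ − 1), one has G(u_s) ≤ q_s ≤ G(u_s + φω^{s−1}), each bound
    -- obtained with a slack δ → 0⁺.
    refine tendsto_of_tendsto_of_tendsto_of_le_of_le' ((hGc.tendsto _).comp hu)
      ((hGc.tendsto _).comp hv) ?_ ?_
    · filter_upwards [eventually_ge_atTop 2] with s hs
      have hlim : Tendsto (fun δ : ℝ => G (Real.goldenRatio * (dotHat (trunc μ s) - 1) - δ))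
          (𝓝[>] 0) (𝓝 (G (Real.goldenRatio * (dotHat (trunc μ s) - 1) - 0))) :=
        ((hGc.comp (continuous_const.sub continuous_id)).tendsto 0).mono_left nhdsWithin_le_nhds
      rw [sub_zero] at hlim
      refine le_of_tendsto hlim ?_
      filter_upwards [self_mem_nhdsWithin] with δ hδ
      exact (hGp _).mono (hq s hs) (hK.eventually (eventually_LBLE (by omega) _ hδ))
    · filter_upwards [eventually_ge_atTop 2] with s hs
      have hlim : Tendsto (fun δ : ℝ => G (Real.goldenRatio * (dotHat (trunc μ s) - 1) +
          Real.goldenRatio * omega ^ (s - 1) + δ)) (𝓝[>] 0)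
          (𝓝 (G (Real.goldenRatio * (dotHat (trunc μ s) - 1) +
            Real.goldenRatio * omega ^ (s - 1) + 0))) :=
        ((hGc.comp (continuous_const.add continuous_id)).tendsto 0).mono_left nhdsWithin_le_nhds
      rw [add_zero] at hlim
      refine ge_of_tendsto hlim ?_
      filter_upwards [self_mem_nhdsWithin] with δ hδ
      exact (hq s hs).mono (hGp _) (hK.eventually (eventually_of_LBLE (by omega) _ hδ))
  · intro x hx y hy hxy
    rw [hGe x hx, hGe y hy]
    exact Φ.strictMono hxy

/-! ### From leading blocks to position distribution -/

theorem HasContinuousLeadingBlockDistribution.exists_positionDistribution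
    {K : ℕ → ℕ} (hK : Tendsto K atTop atTop)
    (h : HasContinuousLeadingBlockDistribution K) :
    ∃ Φ : ℝ ≃o ℝ, HasPositionDistribution K Φ := by
  obtain ⟨-, g, h0, h1, hg, hc, hm⟩ := h
  obtain ⟨Φ, hΦ⟩ := exists_orderIso_extension hc hm h0 h1
  have hΦ0 : Φ 0 = 0 := by rw [hΦ 0 (by simp), h0]
  have hΦ1 : Φ 1 = 1 := by rw [hΦ 1 (by simp), h1]
  refine ⟨Φ, hΦ0, hΦ1, fun a ha => hasProb_of_approx (fun ε hε => ?_) (fun ε hε => ?_)⟩ <;>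
    obtain ⟨δ, hδ, hcont⟩ := Metric.continuous_iff.1 Φ.continuous a ε hε
  · rcases ha.1.eq_or_lt with rfl | ha0
    · exact ⟨_, _, hasProb_false, by rw [hΦ0]; linarith, Eventually.of_forall fun n hn => hn.elim⟩
    -- An expression with value slightly below `a`: for large `s` the whole interval of μ|s stays
    -- below `a`, so LB_s ≤ μ|s eventually implies y ≤ `a`. At `a = 0` there is no room below, and
    -- the empty event serves.
    obtain ⟨μ, hμ, hμ0, hv1, hv2⟩ := exists_isInfExpr_mem_Ioo (le_max_left 0 (a - δ))
      (max_lt ha0 (sub_lt_self a hδ)) ha.2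
    obtain ⟨hv0, hv1⟩ := max_lt_iff.1 hv1
    obtain ⟨q, hq, hqlim⟩ := hg μ hμ hμ0
    rw [← hΦ _ ⟨hv0.le, hv2.le.trans ha.2⟩] at hqlim
    have hd := hcont _ (show dist (Real.goldenRatio * (infDotHat μ - 1)) a < δ by
      rw [Real.dist_eq, abs_lt]; constructor <;> linarith)
    rw [Real.dist_eq, abs_lt] at hd
    have hu := (((tendsto_dotHat_trunc hμ.le_one).sub_const 1).const_mul Real.goldenRatio).add
      tendsto_goldenRatio_mul_omega_pow
    rw [add_zero] at hu
    obtain ⟨s, hs, hqs, hus⟩ := ((eventually_ge_atTop 2).and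
      ((hqlim.eventually (lt_mem_nhds (show Φ a - ε < _ by linarith))).and
        (hu.eventually (gt_mem_nhds hv2)))).exists
    refine ⟨_, _, hq s hs, hqs, ?_⟩
    filter_upwards [hK.eventually (eventually_of_LBLE (by omega) (trunc μ s) (sub_pos.2 hus))]
      with n hn hL
    have := hn hL
    linarith
  · rcases ha.2.eq_or_lt with rfl | ha1
    · exact ⟨_, _, hasProb_true, by rw [hΦ1]; linarith, Eventually.of_forall fun n _ => trivial⟩
    obtain ⟨μ, hμ, hμ0, hv1, hv2⟩ := exists_isInfExpr_mem_Ioo ha.1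
      (lt_min ha1 (lt_add_of_pos_right a hδ)) (min_le_left 1 (a + δ))
    obtain ⟨hv0, hv2⟩ := lt_min_iff.1 hv2
    obtain ⟨q, hq, hqlim⟩ := hg μ hμ hμ0
    rw [← hΦ _ ⟨ha.1.trans hv1.le, hv0.le⟩] at hqlim
    have hd := hcont _ (show dist (Real.goldenRatio * (infDotHat μ - 1)) a < δ by
      rw [Real.dist_eq, abs_lt]; constructor <;> linarith)
    rw [Real.dist_eq, abs_lt] at hd
    have hu := ((tendsto_dotHat_trunc hμ.le_one).sub_const 1).const_mul Real.goldenRatio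
    obtain ⟨s, hs, hqs, hus⟩ := ((eventually_ge_atTop 2).and
      ((hqlim.eventually (gt_mem_nhds (show _ < Φ a + ε by linarith))).and
        (hu.eventually (lt_mem_nhds hv1)))).exists
    refine ⟨_, _, hq s hs, hqs, ?_⟩
    filter_upwards [hK.eventually (eventually_LBLE (by omega) (trunc μ s) (sub_pos.2 hus))]
      with n hn hy
    exact hn (by linarith)

/-! ### Uniform continuations -/

/-- The continuation of `F` all of whose normalized pieces are `Ψ`, extended by the identity to the
left of `1`. -/
noncomputable def pieceExtension (Ψ : ℝ → ℝ) (x : ℝ) : ℝ :=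
  if x < 1 then x else F ⌊x⌋₊ + F (⌊x⌋₊ - 1) * Ψ (Int.fract x)

theorem natFloor_add_fract {x : ℝ} (hx : 0 ≤ x) : (⌊x⌋₊ : ℝ) + Int.fract x = x := by
  rw [natCast_floor_eq_intCast_floor hx, Int.floor_add_fract]

theorem pieceExtension_add {Ψ : ℝ → ℝ} (h0 : Ψ 0 = 0) (h1 : Ψ 1 = 1) {n : ℕ} (hn : 1 ≤ n) {p : ℝ}
    (hp : p ∈ Icc (0 : ℝ) 1) : pieceExtension Ψ (n + p) = F n + F (n - 1) * Ψ p := by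
  have hn' : (1 : ℝ) ≤ n := by exact_mod_cast hn
  rcases hp.2.eq_or_lt with rfl | hp1
  · have : (n : ℝ) + 1 = ((n + 1 : ℕ) : ℝ) := by push_cast; rfl
    rw [pieceExtension, if_neg (by linarith), this, Nat.floor_natCast, Int.fract_natCast, h0, h1,
      F_len_succ hn]
    ring
  · rw [pieceExtension, if_neg (by linarith [hp.1]), add_comm (n : ℝ) p,
      Nat.floor_add_natCast hp.1, Nat.floor_eq_zero.2 hp1, zero_add, Int.fract_add_natCast,
      Int.fract_eq_self.2 ⟨hp.1, hp1⟩]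

theorem strictMono_pieceExtension (Ψ : ℝ ≃o ℝ) (h0 : Ψ 0 = 0) (h1 : Ψ 1 = 1) :
    StrictMono (pieceExtension Ψ) := by
  have hform : ∀ x : ℝ, 1 ≤ x → ∃ (n : ℕ) (p : ℝ), 1 ≤ n ∧ 0 ≤ p ∧ p < 1 ∧ x = n + p ∧
      pieceExtension Ψ x = F n + F (n - 1) * Ψ p := by
    intro x hx
    have hn : 1 ≤ ⌊x⌋₊ := Nat.one_le_floor_iff x |>.2 hx
    refine ⟨⌊x⌋₊, Int.fract x, hn, Int.fract_nonneg x, Int.fract_lt_one x,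
      (natFloor_add_fract (by linarith)).symm, ?_⟩
    rw [pieceExtension, if_neg (not_lt.2 hx)]
  have hlow : ∀ (n : ℕ) (p : ℝ), 0 ≤ p → (F n : ℝ) ≤ F n + F (n - 1) * Ψ p := by
    intro n p hp
    have : 0 ≤ Ψ p := h0 ▸ Ψ.monotone hp
    have := F_cast_pos (n - 1)
    nlinarith
  intro x y hxy
  rcases lt_or_ge y 1 with hy | hy
  · rwa [pieceExtension, if_pos (hxy.trans hy), pieceExtension, if_pos hy]
  obtain ⟨m, q, hm, hq0, hq1, rfl, hfy⟩ := hform y hy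
  rw [hfy]
  rcases lt_or_ge x 1 with hx | hx
  · rw [pieceExtension, if_pos hx]
    have : (1 : ℝ) ≤ F m := by exact_mod_cast F_pos m
    linarith [hlow m q hq0]
  obtain ⟨n, p, hn, hp0, hp1, rfl, hfx⟩ := hform x hx
  rw [hfx]
  have hnm : n ≤ m := by
    have : (n : ℝ) < (m + 1 : ℕ) := by push_cast; linarith
    exact Nat.lt_succ_iff.1 (by exact_mod_cast this)
  rcases hnm.eq_or_lt with rfl | hlt
  · have := Ψ.strictMono (show p < q by linarith)
    have := mul_lt_mul_of_pos_left this (F_cast_pos (n - 1))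
    linarith
  · have h2 : Ψ p < 1 := h1 ▸ Ψ.strictMono hp1
    have h3 := mul_lt_mul_of_pos_left h2 (F_cast_pos (n - 1))
    have h4 : (F (n + 1) : ℝ) ≤ F m := by exact_mod_cast F_mono hlt
    rw [F_len_succ hn] at h4
    linarith [hlow m q hq0]

theorem exists_len_of_one_le {y : ℝ} (hy : 1 ≤ y) :
    ∃ t : ℕ, 1 ≤ t ∧ (F t : ℝ) ≤ y ∧ y < F (t + 1) := by
  obtain ⟨h1, h2, h3⟩ := len_spec (show 0 < ⌊y⌋₊ from Nat.floor_pos.2 hy)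
  exact ⟨len ⌊y⌋₊, h1, (Nat.le_floor_iff (by linarith)).1 h2, (Nat.floor_lt (by linarith)).1 h3⟩

theorem continuous_pieceExtension (Ψ : ℝ ≃o ℝ) (h0 : Ψ 0 = 0) (h1 : Ψ 1 = 1) :
    Continuous (pieceExtension Ψ) := by
  -- A monotone surjection of ℝ is continuous, which avoids gluing at integers; the identity to the
  -- left of 1 makes the function surjective.
  refine (strictMono_pieceExtension Ψ h0 h1).monotone.continuous_of_surjective fun y => ?_
  rcases lt_or_ge y 1 with hy | hy
  · exact ⟨y, by rw [pieceExtension, if_pos hy]⟩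
  obtain ⟨t, ht, hty, hyt⟩ := exists_len_of_one_le hy
  rw [F_len_succ ht] at hyt
  have hF := F_cast_pos (t - 1)
  have h0' : Ψ.symm 0 = 0 := by rw [OrderIso.symm_apply_eq, h0]
  have h1' : Ψ.symm 1 = 1 := by rw [OrderIso.symm_apply_eq, h1]
  refine ⟨t + Ψ.symm ((y - F t) / F (t - 1)), ?_⟩
  rw [pieceExtension_add h0 h1 ht, OrderIso.apply_symm_apply]
  · field_simp
    ring
  · refine ⟨h0' ▸ Ψ.symm.monotone (div_nonneg (by linarith) hF.le), h1' ▸ Ψ.symm.monotone ?_⟩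
    rw [div_le_one hF]
    linarith

theorem isUniformContinuation_pieceExtension (Ψ : ℝ ≃o ℝ) (h0 : Ψ 0 = 0) (h1 : Ψ 1 = 1) :
    IsUniformContinuation F (pieceExtension Ψ) := by
  have hint : ∀ n : ℕ, 1 ≤ n → pieceExtension Ψ n = F n := fun n hn => by
    have := pieceExtension_add h0 h1 hn (p := 0) (by simp)
    simpa [h0] using this
  have hpiece : ∀ n : ℕ, 1 ≤ n → ∀ p ∈ Icc (0 : ℝ) 1, piece (pieceExtension Ψ) n p = Ψ p := by
    intro n hn p hp
    rw [piece, pieceExtension_add h0 h1 hn hp, pieceExtension_add h0 h1 hn (p := 1) (by simp),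
      hint n hn, h1, add_sub_cancel_left, mul_one, add_sub_cancel_left,
      mul_div_cancel_left₀ _ (F_cast_pos (n - 1)).ne']
  refine ⟨(continuous_pieceExtension Ψ h0 h1).continuousOn, hint, fun n hn p hp => ?_,
    Ψ, Ψ.continuous.continuousOn, Ψ.strictMono.strictMonoOn _, ?_⟩
  · rw [hpiece n hn p hp]
    exact ⟨h0 ▸ Ψ.monotone hp.1, h1 ▸ Ψ.monotone hp.2⟩
  · refine Metric.tendstoUniformlyOn_iff.2 fun ε hε => ?_
    filter_upwards [eventually_ge_atTop 1] with n hn p hp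
    rw [hpiece n hn p hp, dist_self]
    exact hε

/-- With all pieces equal to Φ⁻¹, f⁻¹(n) = `len n` + Φ(y(n)). Hence {f⁻¹(n)} ≤ β exactly when y(n) ≤
Φ⁻¹(β), an event of probability β. -/
theorem HasPositionDistribution.exists_continuation {K : ℕ → ℕ}
    (hpos : ∀ n : ℕ, 1 ≤ n → 0 < K n) {Φ : ℝ ≃o ℝ} (h : HasPositionDistribution K Φ) :
    ∃ f : ℝ → ℝ, IsUniformContinuation F f ∧ InjOn f (Ici 1) ∧
      FractEquidistributed (fun n => inv f (K n)) := by
  have h0 : Φ.symm 0 = 0 := by rw [OrderIso.symm_apply_eq, h.map_zero]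
  have h1 : Φ.symm 1 = 1 := by rw [OrderIso.symm_apply_eq, h.map_one]
  have hinj := (strictMono_pieceExtension Φ.symm h0 h1).injective.injOn (s := Ici 1)
  refine ⟨pieceExtension Φ.symm, isUniformContinuation_pieceExtension _ h0 h1, hinj, ?_⟩
  intro β hβ
  have hmem : Φ.symm β ∈ Icc (0 : ℝ) 1 :=
    ⟨h0 ▸ Φ.symm.monotone hβ.1, h1 ▸ Φ.symm.monotone hβ.2⟩
  have := h.hasProb _ hmem
  rw [OrderIso.apply_symm_apply] at this
  refine this.congr' ?_
  filter_upwards [eventually_ge_atTop 1] with n hn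
  have hp0 : 0 ≤ Φ (yval (K n)) := h.map_zero ▸ Φ.monotone (yval_nonneg (hpos n hn))
  have hp1 : Φ (yval (K n)) < 1 := h.map_one ▸ Φ.strictMono (yval_lt_one (hpos n hn))
  obtain ⟨ht, -, -⟩ := len_spec (hpos n hn)
  have hval : pieceExtension Φ.symm (len (K n) + Φ (yval (K n))) = K n := by
    rw [pieceExtension_add h0 h1 ht ⟨hp0, hp1.le⟩, OrderIso.symm_apply_apply, yval]
    have := (F_cast_pos (len (K n) - 1)).ne'
    field_simp
    ring
  have ht' : (1 : ℝ) ≤ len (K n) := by exact_mod_cast ht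
  have hx : (len (K n) + Φ (yval (K n)) : ℝ) ∈ Ici (1 : ℝ) := by
    rw [mem_Ici]; linarith
  have hinv : inv (pieceExtension Φ.symm) (K n) = len (K n) + Φ (yval (K n)) := by
    rw [inv, ← hval]
    exact hinj.leftInvOn_invFunOn hx
  rw [hinv, add_comm, Int.fract_add_natCast, Int.fract_eq_self.2 ⟨hp0, hp1⟩]
  exact Φ.le_symm_apply

/-- A continuous injection on an interval is monotone, and F_1 ≤ F_N fixes the direction. -/
theorem IsUniformContinuation.strictMonoOn {f : ℝ → ℝ} (hf : IsUniformContinuation F f)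
    (hinj : InjOn f (Ici 1)) : StrictMonoOn f (Ici 1) := by
  intro x hx y hy hxy
  obtain ⟨N, hN⟩ := exists_nat_ge y
  have hx1 : (1 : ℝ) ≤ x := hx
  have h1N : (1 : ℝ) ≤ N := by linarith
  have h1N' : 1 ≤ N := by exact_mod_cast h1N
  refine ContinuousOn.strictMonoOn_of_injOn_Icc h1N ?_ (hf.continuousOn.mono Icc_subset_Ici_self)
    (hinj.mono Icc_subset_Ici_self) ⟨hx1, by linarith⟩ ⟨hy, hN⟩ hxy
  have h1 := hf.interpolates 1 le_rfl
  rw [Nat.cast_one] at h1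
  rw [h1, hf.interpolates N h1N']
  exact_mod_cast F_mono h1N'

/-- Monotonicity and F_t ≤ n < F_{t+1} put f⁻¹(n) in [t, t+1), so its fractional part is f⁻¹(n) − t.
-/
theorem IsUniformContinuation.piece_fract_inv {f : ℝ → ℝ} (hf : IsUniformContinuation F f)
    (hinj : InjOn f (Ici 1)) {n : ℕ} (hn : 0 < n) :
    piece f (len n) (Int.fract (inv f n)) = yval n := by
  obtain ⟨ht, h1, h2⟩ := len_spec hn
  have hm := hf.strictMonoOn hinj
  have ht' : (1 : ℝ) ≤ len n := by exact_mod_cast ht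
  have hft := hf.interpolates _ ht
  have hft1 := hf.interpolates (len n + 1) (by omega)
  push_cast at hft1
  have h1' : (F (len n) : ℝ) ≤ n := by exact_mod_cast h1
  have h2' : (n : ℝ) < F (len n + 1) := by exact_mod_cast h2
  have hex : (n : ℝ) ∈ f '' Ici 1 := by
    have := intermediate_value_Icc (show (len n : ℝ) ≤ len n + 1 by linarith)
      (hf.continuousOn.mono fun x hx => ht'.trans hx.1)
    rw [hft, hft1] at this
    obtain ⟨x, hx, hxn⟩ := this ⟨h1', h2'.le⟩
    exact ⟨x, ht'.trans hx.1, hxn⟩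
  have hx1 : inv f n ∈ Ici (1 : ℝ) := Function.invFunOn_mem hex
  have hfx : f (inv f n) = n := Function.invFunOn_eq hex
  have hle : (len n : ℝ) ≤ inv f n := by
    rw [← hm.le_iff_le ht' hx1, hfx, hft]
    exact h1'
  have hlt : inv f n < len n + 1 := by
    rw [← hm.lt_iff_lt hx1 (show (1 : ℝ) ≤ len n + 1 by linarith), hfx, hft1]
    exact h2'
  have hfl : Int.fract (inv f n) = inv f n - len n := by
    rw [Int.fract, sub_right_inj]
    have : ⌊inv f n⌋ = (len n : ℤ) := Int.floor_eq_iff.2 ⟨by simpa using hle, by simpa using hlt⟩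
    rw [this, Int.cast_natCast]
  rw [piece, hfl, add_sub_cancel, hfx, hft, hft1, yval, F_len_succ ht, add_sub_cancel_left]

theorem IsUniformContinuation.exists_positionDistribution {K : ℕ → ℕ}
    (hpos : ∀ n : ℕ, 1 ≤ n → 0 < K n) (hK : Tendsto K atTop atTop) {f : ℝ → ℝ}
    (hf : IsUniformContinuation F f) (hinj : InjOn f (Ici 1))
    (hequi : FractEquidistributed fun n => inv f (K n)) :
    ∃ Φ : ℝ ≃o ℝ, HasPositionDistribution K Φ := by
  obtain ⟨h, hc, hm, hu⟩ := hf.exists_limit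
  have h0 : h 0 = 0 := by
    refine tendsto_nhds_unique (hu.tendsto_at (show (0 : ℝ) ∈ Icc (0 : ℝ) 1 by simp)) ?_
    simp [piece]
  have h1 : h 1 = 1 := by
    refine tendsto_nhds_unique (hu.tendsto_at (show (1 : ℝ) ∈ Icc (0 : ℝ) 1 by simp)) ?_
    refine tendsto_const_nhds.congr' ?_
    filter_upwards [eventually_ge_atTop 1] with n hn
    have hft := hf.interpolates _ hn
    have hft1 := hf.interpolates (n + 1) (by omega)
    push_cast at hft1
    rw [piece, hft, hft1, F_len_succ hn, add_sub_cancel_left, div_self (F_cast_pos _).ne']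
  obtain ⟨Ψ, hΨ⟩ := exists_orderIso_extension hc hm h0 h1
  have hΨ0 : Ψ.symm 0 = 0 := by rw [OrderIso.symm_apply_eq, hΨ 0 (by simp), h0]
  have hΨ1 : Ψ.symm 1 = 1 := by rw [OrderIso.symm_apply_eq, hΨ 1 (by simp), h1]
  refine ⟨Ψ.symm, hΨ0, hΨ1, fun a ha => ?_⟩
  have hfr := hasProb_clamp (z := fun n => Int.fract (inv f (K n))) (Φ := OrderIso.refl ℝ)
    (Eventually.of_forall fun n => ⟨Int.fract_nonneg _, Int.fract_lt_one _⟩) rfl rfl hequi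
  have hz : ∀ a, HasProb (fun n => Ψ (Int.fract (inv f (K n))) ≤ a)
      (max 0 (min 1 (Ψ.symm a))) := fun a =>
    (hfr (Ψ.symm a)).congr' (Eventually.of_forall fun n => Ψ.le_symm_apply)
  rw [← clamp_eq hΨ0 hΨ1 ha]
  -- Uniform convergence is essential: the piece is evaluated at a point that varies with `n`.
  have hclose : ∀ δ > 0, ∀ᶠ n in atTop,
      |Ψ (Int.fract (inv f (K n))) - yval (K n)| < δ := by
    intro δ hδ
    filter_upwards [eventually_ge_atTop 1,
      (tendsto_len.comp hK).eventually (Metric.tendstoUniformlyOn_iff.1 hu δ hδ)] with n hn hd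
    have hmem : Int.fract (inv f (K n)) ∈ Icc (0 : ℝ) 1 :=
      ⟨Int.fract_nonneg _, (Int.fract_lt_one _).le⟩
    have := hd _ hmem
    rwa [Function.comp, hf.piece_fract_inv hinj (hpos n hn), ← hΨ _ hmem, Real.dist_eq] at this
  refine hasProb_of_threshold (G := fun u => max 0 (min 1 (Ψ.symm u)))
    (continuous_const.max (continuous_const.min Ψ.symm.continuous)) hz
    (fun δ hδ => ?_) (fun δ hδ => ?_)
  · filter_upwards [hclose δ hδ] with n hn hy
    linarith [(abs_lt.1 hn).1]
  · filter_upwards [hclose δ hδ] with n hn hy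
    linarith [(abs_lt.1 hn).2]

end ZeckBenford

theorem theorem4p12 (K : ℕ → ℕ) (hpos : ∀ n : ℕ, 1 ≤ n → 0 < K n)
    (hK : Filter.Tendsto K Filter.atTop Filter.atTop) :
    ZeckBenford.HasContinuousLeadingBlockDistribution K ↔
      ∃ f : ℝ → ℝ, ZeckBenford.IsUniformContinuation ZeckBenford.F f ∧
        Set.InjOn f (Set.Ici 1) ∧
        ZeckBenford.FractEquidistributed (fun n => ZeckBenford.inv f (K n)) := by
  constructor
  · intro h
    obtain ⟨Φ, hΦ⟩ := h.exists_positionDistribution hK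
    exact hΦ.exists_continuation hpos
  · rintro ⟨f, hf, hinj, hequi⟩
    obtain ⟨Φ, hΦ⟩ := hf.exists_positionDistribution hpos hK hinj hequi
    exact hΦ.continuousLeadingBlock hpos hK
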